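/- Let $\Sigma$ be a countable first-order language, and let $\mathcal{T}$ be a family of complete (consistent, deductively closed) first-order theories in $\Sigma$. For a set $\Phi$ of $\Sigma$-sentences put $\mathcal{T}_\Phi=\{T\in\mathcal{T}\mid\Phi\subseteq T\}$, and for a sentence $\varphi$ put $\mathcal{T}_\varphi=\mathcal{T}_{\{\varphi\}}$; use the same notation for every other family. A subfamily of $\mathcal{T}$ is $d$-definable if it equals $\mathcal{T}_\Phi$ for some set $\Phi$ of $\Sigma$-sentences, and $d_\infty$-definable if it is a (possibly infinite) union of $d$-definable subfamilies of $\mathcal{T}$. The rank $\mathrm{RS}(\mathcal{S})$ of a family $\mathcal{S}$ of complete $\Sigma$-theories is defined as follows. $\mathrm{RS}(\emptyset)=-1$; $\mathrm{RS}(\mathcal{S})\geq 0$ for nonempty $\mathcal{S}$, with $\mathrm{RS}(\mathcal{S})=0$ for finite nonempty $\mathcal{S}$; $\mathrm{RS}(\mathcal{S})\geq 1$ for infinite $\mathcal{S}$; $\mathrm{RS}(\mathcal{S})\geq\beta+1$ if there are pairwise inconsistent $\Sigma$-sentences $\varphi_k$, $k\in\omega$, with $\mathrm{RS}(\mathcal{S}_{\varphi_k})\geq\beta$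 for all $k$; for a limit ordinal $\alpha$, $\mathrm{RS}(\mathcal{S})\geq\alpha$ if $\mathrm{RS}(\mathcal{S})\geq\beta$ for all $\beta<\alpha$. For an ordinal $\alpha$, $\mathrm{RS}(\mathcal{S})=\alpha$ means $\mathrm{RS}(\mathcal{S})\geq\alpha$ and $\mathrm{RS}(\mathcal{S})\not\geq\alpha+1$; $\mathrm{RS}(\mathcal{S})=\infty$ means $\mathrm{RS}(\mathcal{S})\geq\alpha$ for every ordinal $\alpha$. If $\mathrm{RS}(\mathcal{S})=\alpha\geq 0$ is an ordinal, the degree $\mathrm{ds}(\mathcal{S})$ is the maximal number of pairwise inconsistent $\Sigma$-sentences $\varphi_i$ with $\mathrm{RS}(\mathcal{S}_{\varphi_i})=\alpha$. Suppose that $\mathrm{RS}(\mathcal{T})=\infty$, let $\alpha$ be a countable ordinal and let $n\in\omega\setminus\{0\}$. Then there is a $d_\infty$-definable subfamily $\mathcal{T}^*\subset\mathcal{T}$ such that $\mathrm{RS}(\mathcal{T}^*)=\alpha$ and $\mathrm{ds}(\mathcal{T}^*)=n$. -/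

import Mathlib

universe u v

/-- The subfamily `𝒯_φ` of all theories of the family `𝒯` that contain the sentence `φ`. -/
def sentenceNhd {L : FirstOrder.Language.{u, v}} (𝒯 : Set L.Theory) (φ : L.Sentence) : Set L.Theory :=
  {T ∈ 𝒯 | φ ∈ T}

/-- The subfamily `𝒯_Φ` of all theories of the family `𝒯` that contain every sentence of `Φ`. -/
def diagramNhd {L : FirstOrder.Language.{u, v}} (𝒯 : Set L.Theory) (Φ : Set L.Sentence) : Set L.Theory :=
  {T ∈ 𝒯 | Φ ⊆ T}

/-- A subfamily of `𝒯` is `d`-definable if it is `𝒯_Φ` for some set `Φ` of sentences. -/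
def IsDDefinable {L : FirstOrder.Language.{u, v}} (𝒯 𝒮 : Set L.Theory) : Prop :=
  ∃ Φ : Set L.Sentence, 𝒮 = diagramNhd 𝒯 Φ

/-- A subfamily of `𝒯` is `d_∞`-definable if it is a (possibly infinite) union of `d`-definable
subfamilies of `𝒯`. -/
def IsDInftyDefinable {L : FirstOrder.Language.{u, v}} (𝒯 𝒮 : Set L.Theory) : Prop :=
  ∃ C : Set (Set L.Theory), (∀ D ∈ C, IsDDefinable 𝒯 D) ∧ 𝒮 = ⋃₀ C

/-- Two sentences are inconsistent if they have no common model. -/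
def SentencesInconsistent {L : FirstOrder.Language.{u, v}} (φ ψ : L.Sentence) : Prop :=
  ¬ ({φ, ψ} : L.Theory).IsSatisfiable

/-- `RSGe α 𝒯` means `RS(𝒯) ≥ α`. The empty family (of rank `-1`) has `RS(𝒯) ≥ α` for no
ordinal `α`. -/
inductive RSGe {L : FirstOrder.Language.{u, v}} : Ordinal.{max u v} → Set L.Theory → Prop
  | zero {𝒯 : Set L.Theory} (h : 𝒯.Nonempty) : RSGe 0 𝒯
  | one {𝒯 : Set L.Theory} (h : 𝒯.Infinite) : RSGe 1 𝒯
  | succ {β : Ordinal.{max u v}} {𝒯 : Set L.Theory} (φ : ℕ → L.Sentence)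
      (hφ : Pairwise fun m n => SentencesInconsistent (φ m) (φ n))
      (h : ∀ n, RSGe β (sentenceNhd 𝒯 (φ n))) : RSGe (β + 1) 𝒯
  | limit {α : Ordinal.{max u v}} {𝒯 : Set L.Theory} (hα : Order.IsSuccLimit α)
      (h : ∀ β < α, RSGe β 𝒯) : RSGe α 𝒯

/-- `RS(𝒯) = α` for an ordinal `α` (in particular, `𝒯` is nonempty). -/
def RSEq {L : FirstOrder.Language.{u, v}} (𝒯 : Set L.Theory) (α : Ordinal.{max u v}) : Prop :=
  RSGe α 𝒯 ∧ ¬ RSGe (α + 1) 𝒯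

/-- `RS(𝒯) = ∞`. -/
def RSInfty {L : FirstOrder.Language.{u, v}} (𝒯 : Set L.Theory) : Prop :=
  ∀ α : Ordinal.{max u v}, RSGe α 𝒯

/-- `ds(𝒯) = n`: the rank of `𝒯` is an ordinal `α`, and `n` is the maximal number of pairwise
inconsistent sentences `φ_i` with `RS(𝒯_{φ_i}) = α`. -/
def DSEq {L : FirstOrder.Language.{u, v}} (𝒯 : Set L.Theory) (n : ℕ) : Prop :=
  ∃ α : Ordinal.{max u v}, RSEq 𝒯 α ∧
    IsGreatest {k : ℕ | ∃ φ : Fin k → L.Sentence,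
      (Pairwise fun i j => SentencesInconsistent (φ i) (φ j)) ∧
        ∀ i, RSEq (sentenceNhd 𝒯 (φ i)) α} n

/-!
Every subfamily of `𝒯` is `d_∞`-definable: a maximal theory `T` is the only member of `𝒯` that
contains `T`, so singletons are `d`-definable and a subfamily is the union of its singletons
(`isDInftyDefinable_of_subset`). It remains to find a subfamily with the prescribed rank and degree;
it is automatically proper because `𝒯` itself has rank `∞`.

The rank is monotone in the family, and a finite union has rank `≥ α` only if one of its members
does (`RSGe.exists_of_biUnion`). Since there is only a set of sentences, a family of rank `∞` contains
infinitely many disjoint neighbourhoods of rank `∞` (`RSInfty.exists_pairwise`). In a countable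
language these neighbourhoods can moreover be chosen to converge: one descends through sentences
`χ 0, χ 1, …` with neighbourhoods of rank `∞`, where `χ (k + 1)` decides the `k`-th sentence of the
language and the gap `χ k ⊓ ∼(χ (k + 1))` still has rank `∞`. The gaps are pairwise inconsistent and
every sentence is eventually constant on them (`RSInfty.exists_convergent`).

By induction on the countable ordinal `α`, each family of rank `∞` contains a family that is
*irreducible of rank `α`*, meaning of rank exactly `α` and with no two inconsistent sentences both
having neighbourhoods of rank `≥ α` (`RSInfty.exists_isRSIrreducible`). For `α = 0` take a
singleton. For `α > 0` place into the `k`-th gap an irreducible family of rank `β k < α`, where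
`β` takes each value below `α` infinitely often. The union has rank `≥ α`, while of two inconsistent
sentences at least one fails on almost all gaps, so its neighbourhood lies in a finite union of
families of ranks below `α`.

Finally, `n` irreducible families of rank `α` inside `n` disjoint neighbourhoods have a union of rank
`α`. Its degree is at least `n` by construction and at most `n` by the pigeonhole principle.
-/

open FirstOrder.Language Set

/-! ### Sentences in maximal theories -/

theorem FirstOrder.Language.Theory.IsMaximal.not_mem_iff
    {L : FirstOrder.Language.{u, v}} {T : L.Theory}
    (hT : T.IsMaximal) (φ : L.Sentence) : φ.not ∈ T ↔ φ ∉ T := by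
  refine ⟨fun h h' => ?_, fun h => (hT.mem_or_not_mem φ).resolve_left h⟩
  obtain ⟨M⟩ := hT.1
  exact (Sentence.realize_not M).1 (M.is_model.realize_of_mem _ h) (M.is_model.realize_of_mem _ h')

theorem FirstOrder.Language.Theory.IsMaximal.inf_mem_iff
    {L : FirstOrder.Language.{u, v}} {T : L.Theory}
    (hT : T.IsMaximal) (φ ψ : L.Sentence) : φ ⊓ ψ ∈ T ↔ φ ∈ T ∧ ψ ∈ T := by
  simp only [hT.mem_iff_models, Theory.models_sentence_iff, ← forall_and]
  exact forall_congr' fun M => Sentence.realize_inf M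

theorem FirstOrder.Language.Theory.IsMaximal.eq_of_subset
    {L : FirstOrder.Language.{u, v}} {T T' : L.Theory}
    (hT : T.IsMaximal) (hT' : T'.IsMaximal) (h : T ⊆ T') : T' = T := by
  refine Subset.antisymm (fun φ hφ => ?_) h
  by_contra hn
  exact (hT'.not_mem_iff φ).1 (h ((hT.not_mem_iff φ).2 hn)) hφ

theorem sentencesInconsistent_iff {L : FirstOrder.Language.{u, v}} (φ ψ : L.Sentence) :
    SentencesInconsistent φ ψ ↔ ∀ T : L.Theory, T.IsMaximal → φ ∈ T → ψ ∉ T := by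
  constructor
  · intro h T hT hφ hψ
    exact h (hT.1.mono (by rintro χ (rfl | rfl) <;> assumption))
  · rintro h ⟨M⟩
    exact h _ (completeTheory.isMaximal L M)
      ((mem_completeTheory).2 (M.is_model.realize_of_mem _ (by simp)))
      ((mem_completeTheory).2 (M.is_model.realize_of_mem _ (by simp)))

theorem countable_sentence (L : FirstOrder.Language.{u, v}) [Countable L.Symbols] :
    Countable L.Sentence := by
  have h : Cardinal.mk (Σ n, L.BoundedFormula Empty n) ≤ Cardinal.aleph0 := by
    refine BoundedFormula.card_le.trans (max_le le_rfl ?_)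
    have := Cardinal.mk_le_aleph0_iff.2 ‹Countable L.Symbols›
    rwa [Cardinal.mk_eq_zero, Cardinal.lift_zero, zero_add, Cardinal.lift_le_aleph0]
  have : Countable (Σ n, L.BoundedFormula Empty n) := Cardinal.mk_le_aleph0_iff.1 h
  exact (sigma_mk_injective (β := L.BoundedFormula Empty) (i := 0)).countable

/-! ### Definability of subfamilies -/

theorem isDInftyDefinable_of_subset {L : FirstOrder.Language.{u, v}} {𝒯 𝒮 : Set L.Theory}
    (h𝒯 : ∀ T ∈ 𝒯, T.IsMaximal) (h : 𝒮 ⊆ 𝒯) : IsDInftyDefinable 𝒯 𝒮 := by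
  refine ⟨(fun T => {T}) '' 𝒮, ?_, by simp⟩
  rintro _ ⟨T, hT, rfl⟩
  refine ⟨T, Set.ext fun T' => ⟨?_, ?_⟩⟩
  · rintro rfl
    exact ⟨h hT, Subset.rfl⟩
  · rintro ⟨hT', hs⟩
    exact (h𝒯 T (h hT)).eq_of_subset (h𝒯 T' hT') hs

theorem sentenceNhd_subset {L : FirstOrder.Language.{u, v}} (𝒯 : Set L.Theory) (φ : L.Sentence) :
    sentenceNhd 𝒯 φ ⊆ 𝒯 :=
  fun _ h => h.1

theorem sentenceNhd_mono {L : FirstOrder.Language.{u, v}} {𝒮 𝒯 : Set L.Theory} (h : 𝒮 ⊆ 𝒯)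
    (φ : L.Sentence) : sentenceNhd 𝒮 φ ⊆ sentenceNhd 𝒯 φ :=
  fun _ hT => ⟨h hT.1, hT.2⟩

/-! ### General properties of the rank -/

theorem RSGe.nonempty {L : FirstOrder.Language.{u, v}} {α : Ordinal.{max u v}} {𝒯 : Set L.Theory}
    (h : RSGe α 𝒯) : 𝒯.Nonempty := by
  induction h with
  | zero h => exact h
  | one h => exact h.nonempty
  | succ φ _ _ ih => exact (ih 0).mono (sentenceNhd_subset _ _)
  | limit hα _ ih => exact ih 0 hα.bot_lt

theorem RSGe.mono {L : FirstOrder.Language.{u, v}} {α : Ordinal.{max u v}} {𝒮 𝒯 : Set L.Theory}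
    (h : RSGe α 𝒮) (hs : 𝒮 ⊆ 𝒯) : RSGe α 𝒯 := by
  induction h generalizing 𝒯 with
  | zero h => exact .zero (h.mono hs)
  | one h => exact .one (h.mono hs)
  | succ φ hφ _ ih => exact .succ φ hφ fun n => ih n (sentenceNhd_mono hs _)
  | limit hα _ ih => exact .limit hα fun β hβ => ih β hβ hs

theorem RSGe.of_le {L : FirstOrder.Language.{u, v}} {α β : Ordinal.{max u v}} {𝒯 : Set L.Theory}
    (h : RSGe α 𝒯) (hβ : β ≤ α) : RSGe β 𝒯 := by
  induction h generalizing β with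
  | zero h =>
    obtain rfl : β = 0 := by simpa using hβ
    exact .zero h
  | one h =>
    rcases hβ.lt_or_eq with hlt | rfl
    · obtain rfl : β = 0 := by simpa using hlt
      exact .zero h.nonempty
    · exact .one h
  | @succ γ 𝒯 φ hφ h ih =>
    rcases hβ.lt_or_eq with hlt | rfl
    · exact (ih 0 (Order.lt_add_one_iff.1 hlt)).mono (sentenceNhd_subset _ _)
    · exact .succ φ hφ h
  | limit hα h ih =>
    rcases hβ.lt_or_eq with hlt | rfl
    · exact h β hlt
    · exact .limit hα h

/-- Inversion of `RS(𝒯) ≥ α + 1`. -/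
theorem RSGe.of_add_one {L : FirstOrder.Language.{u, v}} {α : Ordinal.{max u v}} {𝒯 : Set L.Theory}
    (h : RSGe (α + 1) 𝒯) :
    (α = 0 ∧ 𝒯.Infinite) ∨ ∃ φ : ℕ → L.Sentence,
      (Pairwise fun m n => SentencesInconsistent (φ m) (φ n)) ∧
        ∀ n, RSGe α (sentenceNhd 𝒯 (φ n)) := by
  generalize hγ : α + 1 = γ at h
  cases h with
  | zero h => exact absurd hγ (add_pos_of_right zero_lt_one α).ne'
  | one h => exact .inl ⟨Order.succ_injective (hγ.trans (zero_add 1).symm), h⟩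
  | succ φ hφ h =>
    obtain rfl := Order.succ_injective hγ
    exact .inr ⟨φ, hφ, h⟩
  | limit hα h =>
    subst hγ
    exact absurd hα (Order.not_isSuccLimit_add_one α)

theorem RSGe.of_union {L : FirstOrder.Language.{u, v}} {α : Ordinal.{max u v}} {𝒜 ℬ : Set L.Theory}
    (h : RSGe α (𝒜 ∪ ℬ)) : RSGe α 𝒜 ∨ RSGe α ℬ := by
  generalize h𝒯 : 𝒜 ∪ ℬ = 𝒯 at h
  induction h generalizing 𝒜 ℬ with
  | zero h =>
    subst h𝒯
    exact (union_nonempty.1 h).imp .zero .zero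
  | one h =>
    subst h𝒯
    exact (infinite_union.1 h).imp .one .one
  | @succ β 𝒯 φ hφ h ih =>
    subst h𝒯
    have key : ∀ n, RSGe β (sentenceNhd 𝒜 (φ n)) ∨ RSGe β (sentenceNhd ℬ (φ n)) := fun n =>
      @ih n (sentenceNhd 𝒜 (φ n)) (sentenceNhd ℬ (φ n)) (by
      ext T
      simp only [sentenceNhd, mem_union, mem_ofPred_eq]
      tauto)
    -- One of the two families wins along infinitely many of the sentences.
    have hinf : {n | RSGe β (sentenceNhd 𝒜 (φ n))}.Infinite ∨
        {n | RSGe β (sentenceNhd ℬ (φ n))}.Infinite := by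
      rw [← infinite_union]
      convert infinite_univ (α := ℕ)
      exact eq_univ_of_forall key
    refine hinf.imp (fun hi => ?_) (fun hi => ?_)
    all_goals
      exact .succ (fun k => φ (hi.natEmbedding _ k))
        (fun m n hmn => hφ fun he => hmn ((hi.natEmbedding _).injective (Subtype.ext he)))
        fun k => (hi.natEmbedding _ k).2
  | @limit α 𝒯 hα h ih =>
    by_contra! hn
    obtain ⟨β, hβ, h1⟩ : ∃ β < α, ¬ RSGe β 𝒜 := by
      by_contra! hc
      exact hn.1 (.limit hα hc)
    obtain ⟨γ, hγ, h2⟩ : ∃ β < α, ¬ RSGe β ℬ := by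
      by_contra! hc
      exact hn.2 (.limit hα hc)
    rcases ih (max β γ) (max_lt hβ hγ) h𝒯 with h' | h'
    · exact h1 (h'.of_le (le_max_left _ _))
    · exact h2 (h'.of_le (le_max_right _ _))

theorem RSGe.exists_of_biUnion {L : FirstOrder.Language.{u, v}} {ι : Type*} {α : Ordinal.{max u v}}
    {𝒜 : ι → Set L.Theory} (s : Finset ι) (h : RSGe α (⋃ i ∈ s, 𝒜 i)) : ∃ i ∈ s, RSGe α (𝒜 i) := by
  classical
  induction s using Finset.induction_on with
  | empty => simpa using h.nonempty
  | insert a s _ ih =>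
    rw [Finset.set_biUnion_insert] at h
    rcases h.of_union with h | h
    · exact ⟨a, by simp, h⟩
    · obtain ⟨i, hi, h⟩ := ih h
      exact ⟨i, by simp [hi], h⟩

/-- The family `𝒯` has rank `≥ α > 0` as soon as the ranks of its pairwise disjoint
neighbourhoods `𝒯_{φ_k}` reach each `β < α` infinitely often. -/
theorem RSGe.of_forall_lt {L : FirstOrder.Language.{u, v}} {α : Ordinal.{max u v}} {𝒯 : Set L.Theory}
    (hα : α ≠ 0) (φ : ℕ → L.Sentence) (hφ : Pairwise fun m n => SentencesInconsistent (φ m) (φ n))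
    (h : ∀ β < α, ∃ e : ℕ → ℕ, e.Injective ∧ ∀ k, RSGe β (sentenceNhd 𝒯 (φ (e k)))) :
    RSGe α 𝒯 := by
  rcases α.zero_or_succ_or_isSuccLimit with h0 | ⟨β, rfl⟩ | hl
  · exact absurd h0 hα
  · obtain ⟨e, he, hr⟩ := h β (Order.lt_succ β)
    exact .succ (fun k => φ (e k)) (fun m n hmn => hφ (he.ne hmn)) hr
  · refine .limit hl fun β hβ => ?_
    obtain ⟨e, -, hr⟩ := h β hβ
    exact (hr 0).mono (sentenceNhd_subset _ _)

/-! ### Families of infinite rank -/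

theorem RSInfty.mono {L : FirstOrder.Language.{u, v}} {𝒮 𝒯 : Set L.Theory} (h : RSInfty 𝒮)
    (hs : 𝒮 ⊆ 𝒯) : RSInfty 𝒯 :=
  fun α => (h α).mono hs

theorem RSInfty.of_union {L : FirstOrder.Language.{u, v}} {𝒜 ℬ : Set L.Theory} (h : RSInfty (𝒜 ∪ ℬ)) :
    RSInfty 𝒜 ∨ RSInfty ℬ := by
  by_contra! hn
  simp only [RSInfty, not_forall] at hn
  obtain ⟨⟨β, h1⟩, γ, h2⟩ := hn
  rcases (h (max β γ)).of_union with h' | h'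
  · exact h1 (h'.of_le (le_max_left _ _))
  · exact h2 (h'.of_le (le_max_right _ _))

/-- The ranks that occur as ordinals among the neighbourhoods `𝒯_φ` are bounded, so neighbourhoods
of large enough rank have rank `∞`. -/
theorem RSInfty.exists_pairwise {L : FirstOrder.Language.{u, v}} {𝒯 : Set L.Theory} (h : RSInfty 𝒯) :
    ∃ φ : ℕ → L.Sentence, (Pairwise fun m n => SentencesInconsistent (φ m) (φ n)) ∧
      ∀ n, RSInfty (sentenceNhd 𝒯 (φ n)) := by
  have hb : ∀ φ : L.Sentence, ∃ β, RSGe β (sentenceNhd 𝒯 φ) → RSInfty (sentenceNhd 𝒯 φ) := by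
    intro φ
    by_cases hφ : RSInfty (sentenceNhd 𝒯 φ)
    · exact ⟨0, fun _ => hφ⟩
    · simp only [RSInfty, not_forall] at hφ
      obtain ⟨β, hβ⟩ := hφ
      exact ⟨β, fun h => absurd h hβ⟩
  choose b hb using hb
  -- The summand `1` excludes the case of `RSGe.of_add_one` that concerns rank `1`.
  rcases (h ((⨆ φ, b φ) + 1 + 1)).of_add_one with ⟨h0, -⟩ | ⟨φ, hφ, hr⟩
  · exact absurd h0 (add_pos_of_right zero_lt_one _).ne'
  · exact ⟨φ, hφ, fun n => hb _ ((hr n).of_le ((Ordinal.le_iSup b _).trans le_self_add))⟩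

/-- A neighbourhood of rank `∞` shrinks to one of rank `∞` that decides a given sentence `ψ` and
leaves a gap of rank `∞` behind. -/
theorem RSInfty.exists_step {L : FirstOrder.Language.{u, v}} {𝒯 : Set L.Theory}
    (h𝒯 : ∀ T ∈ 𝒯, T.IsMaximal) {χ : L.Sentence} (h : RSInfty (sentenceNhd 𝒯 χ))
    (ψ : L.Sentence) :
    ∃ χ' : L.Sentence, RSInfty (sentenceNhd 𝒯 χ') ∧ RSInfty (sentenceNhd 𝒯 (χ ⊓ χ'.not)) ∧
      (∀ T : L.Theory, T.IsMaximal → χ' ∈ T → χ ∈ T) ∧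
      ((∀ T ∈ 𝒯, χ' ∈ T → ψ ∈ T) ∨ ∀ T ∈ 𝒯, χ' ∈ T → ψ ∉ T) := by
  obtain ⟨φ, hφ, hr⟩ := h.exists_pairwise
  have hinc := (sentencesInconsistent_iff _ _).1 (hφ zero_ne_one)
  -- Any strengthening of `χ ⊓ φ 0` leaves `φ 1` in the gap.
  have hgap : ∀ θ : L.Sentence, RSInfty (sentenceNhd 𝒯 (χ ⊓ ((χ ⊓ φ 0) ⊓ θ).not)) := by
    refine fun θ => (hr 1).mono fun T hT => ⟨hT.1.1, ?_⟩
    have hm := h𝒯 T hT.1.1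
    rw [hm.inf_mem_iff, hm.not_mem_iff, hm.inf_mem_iff, hm.inf_mem_iff]
    exact ⟨hT.1.2, fun h' => hinc T hm h'.1.2 hT.2⟩
  have himp : ∀ θ (T : L.Theory), T.IsMaximal → (χ ⊓ φ 0) ⊓ θ ∈ T → χ ∈ T := by
    intro θ T hm hT
    rw [hm.inf_mem_iff, hm.inf_mem_iff] at hT
    exact hT.1.1
  have hsplit : RSInfty (sentenceNhd 𝒯 ((χ ⊓ φ 0) ⊓ ψ) ∪ sentenceNhd 𝒯 ((χ ⊓ φ 0) ⊓ ψ.not)) := by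
    refine (hr 0).mono fun T hT => ?_
    have hm := h𝒯 T hT.1.1
    by_cases hψ : ψ ∈ T
    · refine .inl ⟨hT.1.1, ?_⟩
      rw [hm.inf_mem_iff, hm.inf_mem_iff]
      exact ⟨⟨hT.1.2, hT.2⟩, hψ⟩
    · refine .inr ⟨hT.1.1, ?_⟩
      rw [hm.inf_mem_iff, hm.inf_mem_iff, hm.not_mem_iff]
      exact ⟨⟨hT.1.2, hT.2⟩, hψ⟩
  rcases hsplit.of_union with h' | h'
  · exact ⟨_, h', hgap _, himp _, .inl fun T hT h => (((h𝒯 T hT).inf_mem_iff _ _).1 h).2⟩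
  · exact ⟨_, h', hgap _, himp _, .inr fun T hT h =>
      ((h𝒯 T hT).not_mem_iff _).1 (((h𝒯 T hT).inf_mem_iff _ _).1 h).2⟩

/-- In a countable language, a family of rank `∞` has disjoint neighbourhoods of rank `∞` that
converge: each sentence is true on almost all of them or false on almost all of them. -/
theorem RSInfty.exists_convergent {L : FirstOrder.Language.{u, v}} [Countable L.Symbols]
    {𝒯 : Set L.Theory} (h𝒯 : ∀ T ∈ 𝒯, T.IsMaximal) (h : RSInfty 𝒯) :
    ∃ φ : ℕ → L.Sentence, (Pairwise fun m n => SentencesInconsistent (φ m) (φ n)) ∧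
      (∀ n, RSInfty (sentenceNhd 𝒯 (φ n))) ∧
      ∀ ψ : L.Sentence, ∃ N, (∀ k ≥ N, ∀ T ∈ sentenceNhd 𝒯 (φ k), ψ ∈ T) ∨
        ∀ k ≥ N, ∀ T ∈ sentenceNhd 𝒯 (φ k), ψ ∉ T := by
  have := countable_sentence L
  have : Nonempty L.Sentence := ⟨⊥⟩
  obtain ⟨e, he⟩ := exists_surjective_nat L.Sentence
  obtain ⟨φ₀, -, h₀⟩ := h.exists_pairwise
  choose step hs1 hs2 hs3 hs4 using
    fun (χ : {χ : L.Sentence // RSInfty (sentenceNhd 𝒯 χ)}) (ψ : L.Sentence) =>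
      RSInfty.exists_step h𝒯 χ.2 ψ
  let χ : ℕ → {χ : L.Sentence // RSInfty (sentenceNhd 𝒯 χ)} := fun k =>
    Nat.rec ⟨φ₀ 0, h₀ 0⟩ (fun k c => ⟨step c (e k), hs1 c (e k)⟩) k
  have hstep : ∀ k, (χ (k + 1)).1 = step (χ k) (e k) := fun k => rfl
  have hanti : ∀ T : L.Theory, T.IsMaximal → ∀ m n, m ≤ n → (χ n).1 ∈ T → (χ m).1 ∈ T := by
    intro T hT m n hmn
    induction n, hmn using Nat.le_induction with
    | base => exact id
    | succ n _ ih => exact fun h => ih (hs3 _ _ T hT (hstep n ▸ h))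
  have hlt : ∀ m n, m < n →
      ∀ T : L.Theory, T.IsMaximal → (χ m).1 ⊓ (χ (m + 1)).1.not ∈ T →
        (χ n).1 ⊓ (χ (n + 1)).1.not ∉ T := by
    intro m n hmn T hT h1 h2
    rw [hT.inf_mem_iff, hT.not_mem_iff] at h1
    exact h1.2 (hanti T hT _ _ hmn ((hT.inf_mem_iff _ _).1 h2).1)
  refine ⟨fun k => (χ k).1 ⊓ (χ (k + 1)).1.not, fun m n hmn => ?_, fun k => hs2 _ _, fun ψ => ?_⟩
  · refine (sentencesInconsistent_iff _ _).2 fun T hT h1 h2 => ?_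
    rcases hmn.lt_or_gt with hmn | hmn
    · exact hlt m n hmn T hT h1 h2
    · exact hlt n m hmn T hT h2 h1
  · obtain ⟨N, rfl⟩ := he ψ
    have hmem : ∀ k ≥ N + 1, ∀ T ∈ sentenceNhd 𝒯 ((χ k).1 ⊓ (χ (k + 1)).1.not),
        step (χ N) (e N) ∈ T := fun k hk T hT =>
      hanti T (h𝒯 T hT.1) (N + 1) k hk (((h𝒯 T hT.1).inf_mem_iff _ _).1 hT.2).1
    exact ⟨N + 1, (hs4 (χ N) (e N)).imp (fun h k hk T hT => h T hT.1 (hmem k hk T hT))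
      (fun h k hk T hT => h T hT.1 (hmem k hk T hT))⟩

/-! ### Irreducible families -/

/-- A family is irreducible of rank `α` if its rank is `α` and no two inconsistent sentences both
have neighbourhoods of rank `≥ α`, that is, its degree is `1`. -/
structure IsRSIrreducible {L : FirstOrder.Language.{u, v}} (α : Ordinal.{max u v})
    (𝒮 : Set L.Theory) : Prop where
  rsEq : RSEq 𝒮 α
  not_rsGe : ∀ φ ψ : L.Sentence, SentencesInconsistent φ ψ → RSGe α (sentenceNhd 𝒮 φ) →
    ¬ RSGe α (sentenceNhd 𝒮 ψ)

theorem not_rsGe_one_of_finite {L : FirstOrder.Language.{u, v}} {𝒮 : Set L.Theory}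
    (hm : ∀ T ∈ 𝒮, T.IsMaximal) (h : 𝒮.Finite) : ¬ RSGe (0 + 1) 𝒮 := by
  intro hr
  rcases hr.of_add_one with ⟨-, hi⟩ | ⟨φ, hφ, hr⟩
  · exact hi h
  · choose T hT using fun n => (hr n).nonempty
    refine infinite_of_injective_forall_mem (f := T) (fun m n hmn => ?_) (fun n => (hT n).1) h
    by_contra hne
    exact (sentencesInconsistent_iff _ _).1 (hφ hne) (T m) (hm _ (hT m).1) (hT m).2
      (hmn ▸ (hT n).2)

theorem isRSIrreducible_singleton {L : FirstOrder.Language.{u, v}} {T : L.Theory} (hT : T.IsMaximal) :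
    IsRSIrreducible 0 {T} where
  rsEq := ⟨.zero (singleton_nonempty T),
    not_rsGe_one_of_finite (by simpa using hT) (finite_singleton T)⟩
  not_rsGe φ ψ hφψ h1 h2 := by
    obtain ⟨_, rfl, hφ⟩ := h1.nonempty
    obtain ⟨_, rfl, hψ⟩ := h2.nonempty
    exact (sentencesInconsistent_iff _ _).1 hφψ _ hT hφ hψ

theorem isRSIrreducible_iUnion {L : FirstOrder.Language.{u, v}} {α : Ordinal.{max u v}} (hα : α ≠ 0)
    {𝒯 : Set L.Theory} {φ : ℕ → L.Sentence}
    (hφ : Pairwise fun m n => SentencesInconsistent (φ m) (φ n))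
    (hconv : ∀ ψ : L.Sentence, ∃ N, (∀ k ≥ N, ∀ T ∈ sentenceNhd 𝒯 (φ k), ψ ∈ T) ∨
      ∀ k ≥ N, ∀ T ∈ sentenceNhd 𝒯 (φ k), ψ ∉ T)
    (h𝒯 : ∀ T ∈ 𝒯, T.IsMaximal)
    {𝒮 : ℕ → Set L.Theory} (hsub : ∀ k, 𝒮 k ⊆ sentenceNhd 𝒯 (φ k))
    (hlt : ∀ k, ¬ RSGe α (𝒮 k))
    (hge : ∀ β < α, ∃ e : ℕ → ℕ, e.Injective ∧ ∀ k, RSGe β (𝒮 (e k))) :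
    IsRSIrreducible α (⋃ k, 𝒮 k) := by
  -- A sentence that fails from some index on has a neighbourhood inside a finite union.
  have hsmall : ∀ (ψ : L.Sentence) (N : ℕ), (∀ k ≥ N, ∀ T ∈ sentenceNhd 𝒯 (φ k), ψ ∉ T) →
      ¬ RSGe α (sentenceNhd (⋃ k, 𝒮 k) ψ) := by
    intro ψ N hN hr
    have hs : sentenceNhd (⋃ k, 𝒮 k) ψ ⊆ ⋃ k ∈ Finset.range N, 𝒮 k := by
      rintro T ⟨hT, hψ⟩
      obtain ⟨k, hk⟩ := mem_iUnion.1 hT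
      refine mem_biUnion (x := k) (Finset.mem_coe.2 (Finset.mem_range.2 ?_)) hk
      by_contra! hle
      exact hN k hle T (hsub k hk) hψ
    obtain ⟨k, -, hk⟩ := (hr.mono hs).exists_of_biUnion
    exact hlt k hk
  have hirr : ∀ ψ ψ' : L.Sentence, SentencesInconsistent ψ ψ' →
      RSGe α (sentenceNhd (⋃ k, 𝒮 k) ψ) → ¬ RSGe α (sentenceNhd (⋃ k, 𝒮 k) ψ') := by
    intro ψ ψ' hψ h1
    obtain ⟨N, hN | hN⟩ := hconv ψ
    · exact hsmall ψ' N fun k hk T hT =>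
        (sentencesInconsistent_iff _ _).1 hψ T (h𝒯 T hT.1) (hN k hk T hT)
    · exact absurd h1 (hsmall ψ N hN)
  refine ⟨⟨.of_forall_lt hα φ hφ fun β hβ => ?_, fun hr => ?_⟩, hirr⟩
  · obtain ⟨e, he, hr⟩ := hge β hβ
    exact ⟨e, he, fun k => (hr k).mono fun T hT => ⟨mem_iUnion_of_mem _ hT, (hsub _ hT).2⟩⟩
  · rcases hr.of_add_one with ⟨h0, -⟩ | ⟨ψ, hψ, hr⟩
    · exact hα h0
    · exact hirr _ _ (hψ zero_ne_one) (hr 0) (hr 1)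

theorem RSInfty.exists_isRSIrreducible {L : FirstOrder.Language.{u, v}} [Countable L.Symbols]
    (α : Ordinal.{max u v}) (hα : α.card ≤ Cardinal.aleph0) {𝒯 : Set L.Theory}
    (h𝒯 : ∀ T ∈ 𝒯, T.IsMaximal) (h : RSInfty 𝒯) : ∃ 𝒮 ⊆ 𝒯, IsRSIrreducible α 𝒮 := by
  induction α using WellFoundedLT.induction generalizing 𝒯 with
  | ind α ih =>
    rcases eq_or_ne α 0 with rfl | h0
    · obtain ⟨T, hT⟩ := (h 0).nonempty
      exact ⟨{T}, by simpa using hT, isRSIrreducible_singleton (h𝒯 T hT)⟩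
    have : Countable (Iio α) := by
      rw [← Cardinal.mk_le_aleph0_iff, Cardinal.mk_Iio_ordinal, Cardinal.lift_le_aleph0]
      exact hα
    have : Nonempty (Iio α) := ⟨⟨0, pos_iff_ne_zero.2 h0⟩⟩
    obtain ⟨f, hf⟩ := exists_surjective_nat (Iio α)
    obtain ⟨φ, hφ, hinf, hconv⟩ := h.exists_convergent h𝒯
    -- Precomposing `f` with `k ↦ k.unpair.1` makes every value occur infinitely often.
    choose 𝒮 hsub hirr using fun k : ℕ =>
      ih (f k.unpair.1) (f k.unpair.1).2
        ((Ordinal.card_le_card (f k.unpair.1).2.le).trans hα)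
        (fun T hT => h𝒯 T (sentenceNhd_subset _ _ hT)) (hinf k)
    refine ⟨⋃ k, 𝒮 k, iUnion_subset fun k => (hsub k).trans (sentenceNhd_subset _ _),
      isRSIrreducible_iUnion h0 hφ hconv h𝒯 hsub (fun k hr => ?_) fun β hβ => ?_⟩
    · exact (hirr k).rsEq.2 (hr.of_le (Order.add_one_le_of_lt (f k.unpair.1).2))
    · obtain ⟨m, hm⟩ := hf ⟨β, hβ⟩
      refine ⟨fun j => Nat.pair m j, fun i j hij => (Nat.pair_eq_pair.1 hij).2, fun j => ?_⟩
      have := (hirr (Nat.pair m j)).rsEq.1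
      simpa [hm] using this

/-! ### Finite unions of irreducible families -/

/-- The union of `n` irreducible families of rank `α`, separated by pairwise inconsistent sentences,
has degree `n`. -/
theorem dsEq_iUnion {L : FirstOrder.Language.{u, v}} {α : Ordinal.{max u v}} {n : ℕ} (hn : 1 ≤ n)
    {𝒮 : Fin n → Set L.Theory} (hirr : ∀ i, IsRSIrreducible α (𝒮 i)) {φ : Fin n → L.Sentence}
    (hφ : Pairwise fun i j => SentencesInconsistent (φ i) (φ j))
    (hsub : ∀ i, ∀ T ∈ 𝒮 i, φ i ∈ T) :
    RSEq (⋃ i, 𝒮 i) α ∧ DSEq (⋃ i, 𝒮 i) n := by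
  have hlt : ¬ RSGe (α + 1) (⋃ i, 𝒮 i) := by
    intro hr
    obtain ⟨i, -, hi⟩ := RSGe.exists_of_biUnion (𝒜 := 𝒮) Finset.univ (by simpa using hr)
    exact (hirr i).rsEq.2 hi
  have hge : ∀ i, RSGe α (sentenceNhd (⋃ i, 𝒮 i) (φ i)) := fun i =>
    (hirr i).rsEq.1.mono fun T hT => ⟨mem_iUnion_of_mem i hT, hsub i T hT⟩
  have heq : RSEq (⋃ i, 𝒮 i) α := ⟨(hge ⟨0, hn⟩).mono (sentenceNhd_subset _ _), hlt⟩
  refine ⟨heq, α, heq, ⟨φ, hφ, fun i => ⟨hge i, fun hr => hlt (hr.mono (sentenceNhd_subset _ _))⟩⟩,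
    ?_⟩
  rintro k ⟨ψ, hψ, hr⟩
  have hex : ∀ j, ∃ i, RSGe α (sentenceNhd (𝒮 i) (ψ j)) := by
    intro j
    have hs : sentenceNhd (⋃ i, 𝒮 i) (ψ j) ⊆ ⋃ i ∈ Finset.univ, sentenceNhd (𝒮 i) (ψ j) := by
      rintro T ⟨hT, hj⟩
      obtain ⟨i, hi⟩ := mem_iUnion.1 hT
      exact mem_biUnion (x := i) (by simp) ⟨hi, hj⟩
    obtain ⟨i, -, hi⟩ := ((hr j).1.mono hs).exists_of_biUnion
    exact ⟨i, hi⟩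
  choose g hg using hex
  have hinj : Function.Injective g := by
    intro a b hab
    by_contra hne
    exact (hirr (g a)).not_rsGe _ _ (hψ hne) (hg a) (hab ▸ hg b)
  simpa using Fintype.card_le_of_injective g hinj

theorem theorem4p8 {L : FirstOrder.Language.{u, v}} [Countable L.Symbols] (𝒯 : Set L.Theory)
    (h𝒯 : ∀ T ∈ 𝒯, T.IsMaximal) (hRS : RSInfty 𝒯)
    (α : Ordinal.{max u v}) (hα : α.card ≤ Cardinal.aleph0) (n : ℕ) (hn : 1 ≤ n) :
    ∃ 𝒯' : Set L.Theory, 𝒯' ⊂ 𝒯 ∧ IsDInftyDefinable 𝒯 𝒯' ∧ RSEq 𝒯' α ∧ DSEq 𝒯' n := by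
  obtain ⟨φ, hφ, hinf⟩ := hRS.exists_pairwise
  choose 𝒮 hsub hirr using fun i : Fin n =>
    (hinf i).exists_isRSIrreducible α hα fun T hT => h𝒯 T (sentenceNhd_subset _ _ hT)
  obtain ⟨heq, hds⟩ := dsEq_iUnion hn hirr (φ := fun i => φ i)
    (fun i j hij => hφ (Fin.val_injective.ne hij)) fun i T hT => (hsub i hT).2
  have hsub' : ⋃ i, 𝒮 i ⊆ 𝒯 := iUnion_subset fun i => (hsub i).trans (sentenceNhd_subset _ _)
  refine ⟨⋃ i, 𝒮 i, ⟨hsub', fun h => ?_⟩, isDInftyDefinable_of_subset h𝒯 hsub', heq, hds⟩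
  exact heq.2 ((hRS (α + 1)).mono h)
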